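/- Let $d\ge 2$ and let $T$ be the $d$-regular rooted tree, whose vertices are the finite words over an alphabet $X$ with $d$ letters; the root is the empty word, each word $w$ is joined to the words $wx$ with $x\in X$, and the $n$-th level $\mathcal L_n$ is the set of words of length $n$. Let $\mathrm{Aut}(T)$ be the group of automorphisms of $T$ fixing the root. For $g\in\mathrm{Aut}(T)$ and a vertex $v$, the section $g|_v\in\mathrm{Aut}(T)$ is the unique automorphism with $g(vw)=g(v)\,g|_v(w)$ for all words $w$; write $\varphi_v(g)=g|_v$. For $G\le\mathrm{Aut}(T)$ let $\mathrm{St}_G(n)$ be the subgroup of all elements of $G$ that fix every vertex of $\mathcal L_n$, and let $\pi_n(G)$ be the finite group of permutations that $G$ induces on the set $T^n$ of words of length at most $n$. A subgroup $G\le\mathrm{Aut}(T)$ is called super strongly fractal if it is self-similar ($g|_v\in G$ for all $g\in G$ and all vertices $v$), level-transitive ($G$ acts transitively on $\mathcal L_n$ for every $n\ge1$), and $\varphi_v(\mathrm{St}_G(n))=G$ for all $n\ge 1$ and all $v\in\mathcal L_n$. Theorem. If $G\le\mathrm{Aut}(T)$ is super strongly fractal, then its fixed-point proportion $$\mathrm{FPP}(G):=\lim_{n\to\infty}\frac{\#\{\sigma\in\pi_n(G):\sigma\text{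 fixes a vertex in }\mathcal L_n\}}{|\pi_n(G)|}$$ exists and equals $0$. -/

import Mathlib

open Filter Topology

namespace RegularTree

/-- The `d`-regular rooted tree: its vertices are the finite words over the alphabet `Fin d`, its
root is the empty word, and two words are adjacent when one of them is obtained from the other by
appending one letter. The level of a vertex is the length of the word. -/
def tree (d : ℕ) : SimpleGraph (List (Fin d)) where
  Adj u v := (∃ x, v = u ++ [x]) ∨ (∃ x, u = v ++ [x])
  symm := ⟨fun _ _ h => h.symm⟩
  loopless := ⟨fun u h => by
    rcases h with ⟨x, h⟩ | ⟨x, h⟩ <;> simpa using congrArg List.length h⟩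

/-- `Aut(T)`: the graph automorphisms of the tree which fix the root. -/
def autSubgroup (d : ℕ) : Subgroup (tree d ≃g tree d) where
  carrier := {g | g [] = []}
  one_mem' := rfl
  mul_mem' := by
    intro a b (ha : a [] = []) (hb : b [] = [])
    change a (b []) = []
    rw [hb, ha]
  inv_mem' := by
    intro a (ha : a [] = [])
    change a.symm [] = []
    rw [RelIso.symm_apply_eq, ha]

/-- The group `Aut(T)` as a type. -/
abbrev Aut (d : ℕ) : Type := ↥(autSubgroup d)

variable {d : ℕ}

/-- Automorphisms act on vertices by evaluation. -/
instance : MulAction (Aut d) (List (Fin d)) where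
  smul g v := g.1 v
  one_smul _ := rfl
  mul_smul _ _ _ := rfl

theorem smul_nil (g : Aut d) : g • ([] : List (Fin d)) = [] := g.2

theorem adj_smul_iff (g : Aut d) (u v : List (Fin d)) :
    (tree d).Adj (g • u) (g • v) ↔ (tree d).Adj u v :=
  g.1.map_rel_iff

theorem smul_child (g : Aut d) (v : List (Fin d)) :
    ∀ x, ∃ y, g • (v ++ [x]) = g • v ++ [y] := by
  induction v using List.reverseRecOn with
  | nil =>
    intro x
    have h := (adj_smul_iff g [] ([] ++ [x])).2 (Or.inl ⟨x, rfl⟩)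
    rcases h with h | ⟨y, h⟩
    · exact h
    · simp [smul_nil] at h
  | append_singleton u z ih =>
    intro x
    have h := (adj_smul_iff g (u ++ [z]) (u ++ [z] ++ [x])).2 (Or.inl ⟨x, rfl⟩)
    rcases h with h | ⟨y, h⟩
    · exact h
    · obtain ⟨y', hy'⟩ := ih z
      rw [hy'] at h
      have h1 := MulAction.injective g (List.append_inj_left' h rfl)
      simpa using congrArg List.length h1

theorem smul_append (g : Aut d) (v w : List (Fin d)) :
    ∃ w', w'.length = w.length ∧ g • (v ++ w) = g • v ++ w' := by
  induction w using List.reverseRecOn with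
  | nil => exact ⟨[], rfl, by simp⟩
  | append_singleton u z ih =>
    obtain ⟨w', hl, hw⟩ := ih
    obtain ⟨y, hy⟩ := smul_child g (v ++ u) z
    refine ⟨w' ++ [y], by simp [hl], ?_⟩
    rw [← List.append_assoc, hy, hw, List.append_assoc]

theorem length_smul (g : Aut d) (v : List (Fin d)) : (g • v).length = v.length := by
  obtain ⟨w', hl, hw⟩ := smul_append g [] v
  rw [List.nil_append] at hw
  rw [hw, smul_nil, List.nil_append, hl]

theorem smul_append_eq (g : Aut d) (v w : List (Fin d)) :
    g • (v ++ w) = g • v ++ (g • (v ++ w)).drop v.length := by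
  obtain ⟨w', _, hw⟩ := smul_append g v w
  rw [hw, ← length_smul g v, List.drop_left]

theorem adj_append_iff (v a b : List (Fin d)) :
    (tree d).Adj (v ++ a) (v ++ b) ↔ (tree d).Adj a b := by
  simp [tree, List.append_assoc]

/-- The section `g|_v`: the automorphism determined by `g (v w) = (g v) (g|_v w)` for all words
`w` (see `smul_append_sectionAt`); the map `φ_v` is `fun g => sectionAt g v`. -/
def sectionAt (g : Aut d) (v : List (Fin d)) : Aut d :=
  ⟨{ toFun := fun w => (g • (v ++ w)).drop v.length
     invFun := fun w => (g⁻¹ • (g • v ++ w)).drop v.length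
     left_inv := fun w => by
       change (g⁻¹ • (g • v ++ (g • (v ++ w)).drop v.length)).drop v.length = w
       rw [← smul_append_eq, inv_smul_smul, List.drop_left]
     right_inv := fun w => by
       change (g • (v ++ (g⁻¹ • (g • v ++ w)).drop v.length)).drop v.length = w
       have h := smul_append_eq g⁻¹ (g • v) w
       rw [inv_smul_smul, length_smul] at h
       rw [← h, smul_inv_smul, ← length_smul g v, List.drop_left]
     map_rel_iff' := fun {a b} => by
       change (tree d).Adj ((g • (v ++ a)).drop v.length) ((g • (v ++ b)).drop v.length) ↔ _
       rw [← adj_append_iff (g • v), ← smul_append_eq, ← smul_append_eq, adj_smul_iff,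
         adj_append_iff] },
   by
     change (g • (v ++ [])).drop v.length = []
     rw [List.append_nil, ← length_smul g v, List.drop_length]⟩

theorem smul_append_sectionAt (g : Aut d) (v w : List (Fin d)) :
    g • (v ++ w) = g • v ++ sectionAt g v • w :=
  smul_append_eq g v w

/-- `St(n)`: the automorphisms which fix every vertex of level `n`. -/
def levelStabilizer (d n : ℕ) : Subgroup (Aut d) :=
  ⨅ v ∈ {v : List (Fin d) | v.length = n}, MulAction.stabilizer (Aut d) v

/-- `G` is self-similar: every section of an element of `G` is in `G`. -/
def IsSelfSimilar (G : Subgroup (Aut d)) : Prop :=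
  ∀ v : List (Fin d), ∀ g ∈ G, sectionAt g v ∈ G

/-- `G` acts transitively on every level of the tree. -/
def IsLevelTransitive (G : Subgroup (Aut d)) : Prop :=
  ∀ n : ℕ, 1 ≤ n → ∀ u v : List (Fin d), u.length = n → v.length = n → ∃ g ∈ G, g • u = v

/-- `G` is super strongly fractal: it is self-similar, level-transitive, and
`φ_v (St_G(n)) = G` for all `n ≥ 1` and all vertices `v` of level `n`. -/
structure IsSuperStronglyFractal (G : Subgroup (Aut d)) : Prop where
  selfSimilar : IsSelfSimilar G
  levelTransitive : IsLevelTransitive G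
  image_section : ∀ n : ℕ, 1 ≤ n → ∀ v : List (Fin d), v.length = n →
    (fun g : Aut d => sectionAt g v) '' ((levelStabilizer d n ⊓ G : Subgroup (Aut d)) : Set (Aut d))
      = (G : Set (Aut d))

/-- The vertices of the truncated tree `T^n`: the words of length at most `n`. -/
abbrev Truncated (d n : ℕ) : Type := {v : List (Fin d) // v.length ≤ n}

instance (n : ℕ) : Finite (Truncated d n) := (List.finite_length_le (Fin d) n).to_subtype

/-- `Aut(T)` acts on the truncated tree `T^n`. -/
instance (n : ℕ) : MulAction (Aut d) (Truncated d n) where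
  smul g v := ⟨g • v.1, (length_smul g v.1).trans_le v.2⟩
  one_smul _ := rfl
  mul_smul _ _ _ := rfl

/-- `π_n`: restriction of automorphisms to the truncated tree `T^n`. -/
def truncation (d n : ℕ) : Aut d →* Equiv.Perm (Truncated d n) :=
  MulAction.toPermHom (Aut d) (Truncated d n)

/-- The proportion of elements of the finite group `π_n(G)` which fix a vertex of level `n`. -/
noncomputable def levelFPP (G : Subgroup (Aut d)) (n : ℕ) : ℝ :=
  (Set.ncard {σ : Equiv.Perm (Truncated d n) |
      σ ∈ G.map (truncation d n) ∧ ∃ v : Truncated d n, v.1.length = n ∧ σ v = v} : ℝ) /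
    (Nat.card (G.map (truncation d n)) : ℝ)

/-- The fixed-point proportion `FPP(G)`, the limit of `levelFPP G n` as `n` tends to infinity. -/
noncomputable def FPP (G : Subgroup (Aut d)) : ℝ :=
  limUnder atTop (levelFPP G)

end RegularTree

namespace RegularTree

/-! Write p_m for `levelFPP G m` and count fixed points at level n + m by their ancestors v at level
n. The stabilizer of v has index d^n in G and its sections at v fill G, so the proportion fixing
something below v is p_m / d^n; these sum to p_m over the d^n vertices, and the union bound gives
p_{n+m} ≤ p_m. The union bound is wasteful on St_G(n): there each v separately has proportion p_m,
so the sum is d^n p_m, while the union has proportion at most 1. Hence d^n p_m - 1 ≤ [G : St_G(n)]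
(p_m - p_{n+m}) (`pow_mul_levelFPP_sub_one_le`). With n fixed and m → ∞ the right side vanishes, so
the limit p satisfies d^n p ≤ 1 for every n ≥ 1, forcing p = 0. -/

/-! ### Counting in groups and double counting -/

/-- Corresponding sets under two surjections onto finite groups, the second of which factors
through the first, have the same proportion. -/
theorem ncard_mul_card_eq_of_ker_le {Γ A B : Type*} [Group Γ] [Group A] [Group B] [Finite A]
    [Finite B] {f : Γ →* A} {h : Γ →* B} (hf : Function.Surjective f)
    (hh : Function.Surjective h) (hker : f.ker ≤ h.ker) {Q : Set A} {P : Set B}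
    (hQP : ∀ s, f s ∈ Q ↔ h s ∈ P) :
    Q.ncard * Nat.card B = P.ncard * Nat.card A := by
  let p : A →* B := f.liftOfSurjective hf ⟨h, hker⟩
  have hp : ∀ s, p (f s) = h s := fun s => f.liftOfRightInverse_comp_apply _ _ ⟨h, hker⟩ s
  have hps : Function.Surjective p := fun b => by
    obtain ⟨s, rfl⟩ := hh b
    exact ⟨f s, hp s⟩
  have hQ : Q = p ⁻¹' P := by
    ext a
    obtain ⟨s, rfl⟩ := hf a
    rw [hQP, Set.mem_preimage, hp]
  -- All fibres of `p` are cosets of its kernel; a set-theoretic section `c` trivializes them.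
  have key : ∀ R : Set B, (p ⁻¹' R).ncard = R.ncard * Nat.card p.ker := by
    intro R
    choose c hc using hps
    let e : (p ⁻¹' R) ≃ R × p.ker :=
      { toFun := fun a => (⟨p a, a.2⟩, ⟨(c (p a))⁻¹ * a, by simp [MonoidHom.mem_ker, hc]⟩)
        invFun := fun x => ⟨c x.1 * x.2, by
          have hx : p x.2 = 1 := x.2.2
          simp [hc, hx]⟩
        left_inv := fun a => by simp
        right_inv := fun x => by
          have hx : p x.2 = 1 := x.2.2
          ext <;> simp [hc, hx] }
    rw [← Nat.card_coe_set_eq, Nat.card_congr e, Nat.card_prod, Nat.card_coe_set_eq]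
  have hA := key Set.univ
  rw [Set.preimage_univ, Set.ncard_univ, Set.ncard_univ] at hA
  rw [hQ, key P, hA]
  ring

/-- Since `S` contains the part of the kernel lying in `G`, passing to the image preserves the
index. -/
theorem card_map_mul_relIndex {Γ A : Type*} [Group Γ] [Group A] (f : Γ →* A)
    {S G : Subgroup Γ} (hSG : S ≤ G) (hker : f.ker ⊓ G ≤ S) :
    Nat.card (S.map f) * S.relIndex G = Nat.card (G.map f) := by
  rw [← Subgroup.relIndex_ker, ← Subgroup.relIndex_ker, ← Subgroup.inf_relIndex_right f.ker S,
    ← Subgroup.inf_relIndex_right f.ker G]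
  have h : f.ker ⊓ S = f.ker ⊓ G :=
    le_antisymm (inf_le_inf_left _ hSG) (le_inf inf_le_left hker)
  rw [h, Subgroup.relIndex_mul_relIndex _ _ _ hker hSG]

/-- If every point of `L` is counted, then counting incidences over `K` exceeds counting points
with an incidence at least by the excess over `L`. -/
theorem sum_card_filter_add_card_le {α β : Type*} {K L : Finset α} (hLK : L ⊆ K) (V : Finset β)
    (R : β → α → Prop) [∀ v, DecidablePred (R v)] [DecidablePred fun a => ∃ v ∈ V, R v a] :
    ∑ v ∈ V, (L.filter (R v)).card + (K.filter fun a => ∃ v ∈ V, R v a).card ≤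
      ∑ v ∈ V, (K.filter (R v)).card + L.card := by
  classical
  simp only [Finset.card_filter, Finset.card_eq_sum_ones L]
  rw [Finset.sum_comm, Finset.sum_comm (s := V) (t := K),
    ← Finset.sum_sdiff (s₁ := L) (s₂ := K) (f := fun a => ∑ v ∈ V, if R v a then 1 else 0) hLK,
    ← Finset.sum_sdiff (s₁ := L) (s₂ := K) (f := fun a => if ∃ v ∈ V, R v a then 1 else 0) hLK]
  -- The trivial bound 1 is used on `L`, the union bound only off `L`.
  have h1 : ∑ a ∈ L, (if ∃ v ∈ V, R v a then 1 else 0) ≤ ∑ a ∈ L, 1 :=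
    Finset.sum_le_sum fun a _ => by split_ifs <;> simp
  have h2 : ∑ a ∈ K \ L, (if ∃ v ∈ V, R v a then 1 else 0) ≤
      ∑ a ∈ K \ L, ∑ v ∈ V, if R v a then 1 else 0 := by
    refine Finset.sum_le_sum fun a _ => ?_
    split_ifs with h
    · obtain ⟨v, hv, hva⟩ := h
      have := Finset.single_le_sum (f := fun v => if R v a then 1 else 0)
        (fun _ _ => Nat.zero_le _) hv
      simpa [hva] using this
    · exact Nat.zero_le _
  omega

/-! ### Sections, truncations and fixed points below a vertex -/

variable {d : ℕ}

theorem aut_ext {g h : Aut d} (H : ∀ w : List (Fin d), g • w = h • w) : g = h :=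
  Subtype.ext (RelIso.ext H)

theorem sectionAt_mul (g h : Aut d) (v : List (Fin d)) :
    sectionAt (g * h) v = sectionAt g (h • v) * sectionAt h v := by
  refine aut_ext fun w => List.append_cancel_left (as := (g * h) • v) ?_
  rw [← smul_append_sectionAt, mul_smul, smul_append_sectionAt, smul_append_sectionAt, mul_smul,
    mul_smul]

/-- The section map at `v` on a group of automorphisms which fix `v`. -/
def sectionHom (S : Subgroup (Aut d)) (v : List (Fin d))
    (hS : S ≤ MulAction.stabilizer (Aut d) v) : S →* Aut d :=
  MonoidHom.mk' (fun g => sectionAt g.1 v) fun a b => by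
    have hb : b.1 • v = v := hS b.2
    rw [Subgroup.coe_mul, sectionAt_mul, hb]

theorem mem_ker_truncation {n : ℕ} {g : Aut d} :
    g ∈ (truncation d n).ker ↔ ∀ v : List (Fin d), v.length ≤ n → g • v = v := by
  rw [MonoidHom.mem_ker]
  constructor
  · intro h v hv
    exact congrArg Subtype.val (DFunLike.congr_fun h (⟨v, hv⟩ : Truncated d n))
  · intro h
    ext1 v
    exact Subtype.ext (h v.1 v.2)

/-- The permutation `σ` of `T^N` fixes a vertex of level `N` below `v`. -/
def FixesBelow {N : ℕ} (v : List (Fin d)) (σ : Equiv.Perm (Truncated d N)) : Prop :=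
  ∃ u : Truncated d N, u.1.length = N ∧ v <+: u.1 ∧ σ u = u

theorem fixesBelow_truncation {N : ℕ} (v : List (Fin d)) (g : Aut d) :
    FixesBelow v (truncation d N g) ↔
      ∃ u : List (Fin d), u.length = N ∧ v <+: u ∧ g • u = u := by
  constructor
  · rintro ⟨u, h1, h2, h3⟩
    exact ⟨u.1, h1, h2, congrArg Subtype.val h3⟩
  · rintro ⟨u, h1, h2, h3⟩
    exact ⟨⟨u, h1.le⟩, h1, h2, Subtype.ext h3⟩

theorem levelFPP_eq (G : Subgroup (Aut d)) (n : ℕ) :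
    levelFPP G n = ({σ | σ ∈ G.map (truncation d n) ∧ FixesBelow [] σ}.ncard : ℝ) /
      Nat.card (G.map (truncation d n)) := by
  simp [levelFPP, FixesBelow]

theorem fixesBelow_add_iff {n m : ℕ} {v : List (Fin d)} (hv : v.length = n) {g : Aut d}
    (hg : g • v = v) :
    FixesBelow v (truncation d (n + m) g) ↔
      FixesBelow [] (truncation d m (sectionAt g v)) := by
  rw [fixesBelow_truncation, fixesBelow_truncation]
  constructor
  · rintro ⟨u, h1, ⟨w, rfl⟩, h3⟩
    refine ⟨w, by simpa [hv] using h1, List.nil_prefix, ?_⟩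
    rw [smul_append_sectionAt, hg] at h3
    exact List.append_cancel_left h3
  · rintro ⟨w, h1, -, h3⟩
    refine ⟨v ++ w, by simp [hv, h1], List.prefix_append _ _, ?_⟩
    rw [smul_append_sectionAt, hg, h3]

theorem smul_eq_of_smul_append_eq {g : Aut d} {v w : List (Fin d)} (h : g • (v ++ w) = v ++ w) :
    g • v = v := by
  rw [smul_append_sectionAt] at h
  exact List.append_inj_left h (length_smul g v)

theorem ncard_setOf_mem_subgroup {A : Type*} [Group A] (K : Subgroup A) (P : A → Prop) :
    {a | a ∈ K ∧ P a}.ncard = {a : K | P a}.ncard := by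
  rw [← Set.ncard_image_of_injective _ (Subtype.val_injective : Function.Injective K.subtype)]
  congr 1
  ext a
  simp [and_comm]

/-- If `S` fixes the level-`n` vertex `v` and its sections at `v` fill out `G`, then the proportion
of `S` fixing a vertex of level `n + m` below `v` equals the fixed-point proportion of `G` at
level `m`. -/
theorem ncard_fixesBelow_of_image_section {G S : Subgroup (Aut d)} {n m : ℕ} {v : List (Fin d)}
    (hv : v.length = n) (hS : S ≤ MulAction.stabilizer (Aut d) v)
    (himage : (fun g => sectionAt g v) '' (S : Set (Aut d)) = G) :
    ({σ | σ ∈ S.map (truncation d (n + m)) ∧ FixesBelow v σ}.ncard : ℝ) =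
      Nat.card (S.map (truncation d (n + m))) * levelFPP G m := by
  let φ : S →* G := (sectionHom S v hS).codRestrict G fun s => by
    rw [← SetLike.mem_coe, ← himage]
    exact ⟨s.1, s.2, rfl⟩
  have hφ : Function.Surjective φ := by
    rintro ⟨g, hg⟩
    rw [← SetLike.mem_coe, ← himage] at hg
    obtain ⟨s, hs, rfl⟩ := hg
    exact ⟨⟨s, hs⟩, rfl⟩
  -- Trivial action down to depth n + m makes the section at `v` trivial to depth m.
  have hker : ((truncation d (n + m)).subgroupMap S).ker ≤
      (((truncation d m).subgroupMap G).comp φ).ker := by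
    intro s hs
    have hs' : s.1 ∈ (truncation d (n + m)).ker := congrArg Subtype.val hs
    have : sectionAt s.1 v ∈ (truncation d m).ker := by
      rw [mem_ker_truncation] at hs' ⊢
      intro w hw
      refine List.append_cancel_left (as := s.1 • v) ?_
      rw [← smul_append_sectionAt, hs' _ (by simp [hv, hw]), hs' v (by omega)]
    exact Subtype.ext this
  have key := ncard_mul_card_eq_of_ker_le
    (MonoidHom.subgroupMap_surjective (truncation d (n + m)) S)
    (((truncation d m).subgroupMap_surjective G).comp hφ) hker
    (Q := {σ | FixesBelow v σ.1}) (P := {σ | FixesBelow [] σ.1})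
    (fun s => fixesBelow_add_iff hv (hS s.2))
  have hB : (Nat.card (G.map (truncation d m)) : ℝ) ≠ 0 := by
    exact_mod_cast Nat.card_pos.ne'
  rw [levelFPP_eq, ncard_setOf_mem_subgroup, ncard_setOf_mem_subgroup, ← mul_div_assoc,
    eq_div_iff hB, mul_comm (Nat.card _ : ℝ)]
  exact_mod_cast key

/-! ### Level and vertex stabilizers -/

theorem mem_levelStabilizer {n : ℕ} {g : Aut d} :
    g ∈ levelStabilizer d n ↔ ∀ v : List (Fin d), v.length = n → g • v = v := by
  simp [levelStabilizer, Subgroup.mem_iInf]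

theorem levelStabilizer_le_stabilizer {v : List (Fin d)} :
    levelStabilizer d v.length ≤ MulAction.stabilizer (Aut d) v :=
  fun _ hg => mem_levelStabilizer.1 hg v rfl

/-- The finite set of vertices of level `n`. -/
noncomputable def level (d n : ℕ) : Finset (List (Fin d)) :=
  (List.finite_length_eq (Fin d) n).toFinset

@[simp]
theorem mem_level {n : ℕ} {v : List (Fin d)} : v ∈ level d n ↔ v.length = n := by
  simp [level]

theorem card_level (d n : ℕ) : (level d n).card = d ^ n := by
  rw [level, ← Set.ncard_eq_toFinset_card _ (List.finite_length_eq (Fin d) n),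
    ← Nat.card_coe_set_eq]
  exact (Nat.card_eq_fintype_card (α := List.Vector (Fin d) n)).trans (by simp)

variable {G : Subgroup (Aut d)}

theorem IsLevelTransitive.relIndex_stabilizer (hG : IsLevelTransitive G) {n : ℕ} (hn : 1 ≤ n)
    {v : List (Fin d)} (hv : v.length = n) :
    (G ⊓ MulAction.stabilizer (Aut d) v).relIndex G = d ^ n := by
  have horbit : MulAction.orbit G v = (level d n : Set (List (Fin d))) := by
    ext u
    rw [Finset.mem_coe, mem_level]
    constructor
    · rintro ⟨g, rfl⟩
      exact (length_smul g.1 v).trans hv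
    · intro hu
      obtain ⟨g, hg, rfl⟩ := hG n hn v u hv hu
      exact ⟨⟨g, hg⟩, rfl⟩
  rw [Subgroup.inf_relIndex_left, ← card_level, ← Set.ncard_coe_finset, ← horbit,
    ← MulAction.index_stabilizer]
  rfl

/-- The vertex stabilizer contains St_G(n), whose sections already fill G; self-similarity gives the
other inclusion. -/
theorem IsSuperStronglyFractal.image_section_stabilizer (hG : IsSuperStronglyFractal G)
    {n : ℕ} (hn : 1 ≤ n) {v : List (Fin d)} (hv : v.length = n) :
    (fun g => sectionAt g v) ''
      ((G ⊓ MulAction.stabilizer (Aut d) v : Subgroup (Aut d)) : Set (Aut d)) = G := by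
  apply Set.Subset.antisymm
  · rintro _ ⟨g, hg, rfl⟩
    exact hG.selfSimilar v g hg.1
  · rw [← hG.image_section n hn v hv]
    refine Set.image_mono fun g hg => ⟨hg.2, ?_⟩
    subst hv
    exact levelStabilizer_le_stabilizer hg.1

theorem FixesBelow.smul_eq {N : ℕ} {v : List (Fin d)} {g : Aut d}
    (h : FixesBelow v (truncation d N g)) : g • v = v := by
  obtain ⟨_, _, ⟨w, rfl⟩, h3⟩ := (fixesBelow_truncation v g).1 h
  exact smul_eq_of_smul_append_eq h3

/-- Fixing a vertex below `v` forces fixing `v`, so only the stabilizer of `v`, of index d^n by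
transitivity, contributes. -/
theorem IsSuperStronglyFractal.ncard_fixesBelow (hG : IsSuperStronglyFractal G) {n m : ℕ}
    (hn : 1 ≤ n) {v : List (Fin d)} (hv : v.length = n) :
    (d : ℝ) ^ n * {σ | σ ∈ G.map (truncation d (n + m)) ∧ FixesBelow v σ}.ncard =
      Nat.card (G.map (truncation d (n + m))) * levelFPP G m := by
  have hcard := card_map_mul_relIndex (truncation d (n + m))
    (inf_le_left : G ⊓ MulAction.stabilizer (Aut d) v ≤ G)
    (fun g hg => ⟨hg.2, mem_ker_truncation.1 hg.1 v (by omega)⟩)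
  rw [hG.levelTransitive.relIndex_stabilizer hn hv] at hcard
  have hset : {σ | σ ∈ G.map (truncation d (n + m)) ∧ FixesBelow v σ} =
      {σ | σ ∈ (G ⊓ MulAction.stabilizer (Aut d) v).map (truncation d (n + m)) ∧
        FixesBelow v σ} := by
    ext σ
    constructor
    · rintro ⟨⟨g, hg, rfl⟩, h⟩
      exact ⟨⟨g, ⟨hg, h.smul_eq⟩, rfl⟩, h⟩
    · rintro ⟨⟨g, hg, rfl⟩, h⟩
      exact ⟨⟨g, hg.1, rfl⟩, h⟩
  rw [hset, ncard_fixesBelow_of_image_section hv inf_le_right (hG.image_section_stabilizer hn hv),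
    ← hcard]
  push_cast
  ring

theorem fixesBelow_nil_iff {n m : ℕ} {σ : Equiv.Perm (Truncated d (n + m))} :
    FixesBelow [] σ ↔ ∃ v ∈ level d n, FixesBelow v σ := by
  constructor
  · rintro ⟨u, h1, -, h3⟩
    exact ⟨u.1.take n, by simp [h1], u, h1, List.take_prefix _ _, h3⟩
  · rintro ⟨v, -, u, h1, -, h3⟩
    exact ⟨u, h1, List.nil_prefix, h3⟩

/-! ### The improved union bound and the limit -/

/-- The inequality between fixed-point counts at level `n + m` obtained from
`sum_card_filter_add_card_le` for a subset `L` of `π_{n+m}(G)`. -/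
theorem IsSuperStronglyFractal.sum_ncard_add_le (hG : IsSuperStronglyFractal G) (hd : d ≠ 0)
    {n m : ℕ} (hn : 1 ≤ n) {L : Set (Equiv.Perm (Truncated d (n + m)))}
    (hL : L ⊆ G.map (truncation d (n + m))) :
    ∑ v ∈ level d n, ({σ | σ ∈ L ∧ FixesBelow v σ}.ncard : ℝ) +
        Nat.card (G.map (truncation d (n + m))) * levelFPP G (n + m) ≤
      Nat.card (G.map (truncation d (n + m))) * levelFPP G m + L.ncard := by
  classical
  have hfilter : ∀ (A : Set (Equiv.Perm (Truncated d (n + m))))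
      (P : Equiv.Perm (Truncated d (n + m)) → Prop),
      {σ | σ ∈ A ∧ P σ}.ncard = (A.toFinite.toFinset.filter P).card := by
    intro A P
    rw [← Set.ncard_coe_finset]
    congr 1
    ext σ
    simp
  have key := sum_card_filter_add_card_le (K := (Set.toFinite
    (G.map (truncation d (n + m)) : Set (Equiv.Perm (Truncated d (n + m))))).toFinset)
    (L := L.toFinite.toFinset) (by simpa using hL) (level d n) FixesBelow
  rw [← Set.ncard_eq_toFinset_card L] at key
  simp only [← hfilter, ← fixesBelow_nil_iff, SetLike.mem_coe] at key
  have hK : (Nat.card (G.map (truncation d (n + m))) : ℝ) ≠ 0 := by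
    exact_mod_cast Nat.card_pos.ne'
  have hsum : ∑ v ∈ level d n,
      ({σ | σ ∈ G.map (truncation d (n + m)) ∧ FixesBelow v σ}.ncard : ℝ) =
      Nat.card (G.map (truncation d (n + m))) * levelFPP G m := by
    have hd' : (d : ℝ) ^ n ≠ 0 := by positivity
    apply mul_left_cancel₀ hd'
    rw [Finset.mul_sum, Finset.sum_congr rfl fun v hv =>
      hG.ncard_fixesBelow (m := m) hn (mem_level.1 hv), Finset.sum_const, card_level, nsmul_eq_mul]
    push_cast
    ring
  rw [← hsum, levelFPP_eq G (n + m), mul_div_cancel₀ _ hK]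
  exact_mod_cast key

theorem IsSuperStronglyFractal.levelFPP_antitone (hG : IsSuperStronglyFractal G) (hd : d ≠ 0) :
    Antitone (levelFPP G) := by
  refine antitone_nat_of_succ_le fun m => ?_
  -- With `L` empty and n = 1 this is the plain union bound.
  have h := hG.sum_ncard_add_le hd (m := m) le_rfl (Set.empty_subset _)
  have hK : (0 : ℝ) < Nat.card (G.map (truncation d (1 + m))) := by exact_mod_cast Nat.card_pos
  simp only [Set.mem_empty_iff_false, false_and, Set.ncard_empty, Set.ofPred_false,
    Nat.cast_zero, Finset.sum_const_zero, zero_add, add_zero] at h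
  rw [add_comm m 1]
  exact le_of_mul_le_mul_left h hK

theorem IsSuperStronglyFractal.pow_mul_levelFPP_sub_one_le (hG : IsSuperStronglyFractal G)
    (hd : d ≠ 0) {n : ℕ} (hn : 1 ≤ n) (m : ℕ) :
    (d : ℝ) ^ n * levelFPP G m - 1 ≤
      (levelStabilizer d n ⊓ G).relIndex G * (levelFPP G m - levelFPP G (n + m)) := by
  set S := levelStabilizer d n ⊓ G
  have hcard := card_map_mul_relIndex (truncation d (n + m)) (inf_le_right : S ≤ G)
    (fun g hg => ⟨mem_levelStabilizer.2 fun v hv => mem_ker_truncation.1 hg.1 v (by omega), hg.2⟩)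
  have h := hG.sum_ncard_add_le hd (m := m) hn
    (L := (S.map (truncation d (n + m)) : Set (Equiv.Perm (Truncated d (n + m)))))
    (Subgroup.map_mono inf_le_right)
  have hsec : ∀ v ∈ level d n,
      ({σ | σ ∈ S.map (truncation d (n + m)) ∧ FixesBelow v σ}.ncard : ℝ) =
        Nat.card (S.map (truncation d (n + m))) * levelFPP G m := by
    intro v hv
    obtain rfl := mem_level.1 hv
    exact ncard_fixesBelow_of_image_section rfl
      (inf_le_left.trans levelStabilizer_le_stabilizer)
      (hG.image_section _ hn _ rfl)
  simp only [SetLike.mem_coe] at h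
  rw [Finset.sum_congr rfl hsec, Finset.sum_const, card_level, nsmul_eq_mul, ← hcard,
    ← Nat.card_coe_set_eq, SetLike.coe_sort_coe] at h
  have hL : (0 : ℝ) < Nat.card (S.map (truncation d (n + m))) := by exact_mod_cast Nat.card_pos
  push_cast at h
  refine le_of_mul_le_mul_left ?_ hL
  linarith

theorem IsSuperStronglyFractal.tendsto_levelFPP (hG : IsSuperStronglyFractal G) (hd : 2 ≤ d) :
    Tendsto (levelFPP G) atTop (𝓝 0) := by
  have hnonneg : ∀ m, 0 ≤ levelFPP G m := fun m => div_nonneg (Nat.cast_nonneg _)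
    (Nat.cast_nonneg _)
  have hlim := tendsto_atTop_ciInf (hG.levelFPP_antitone (by omega))
    ⟨0, by rintro _ ⟨m, rfl⟩; exact hnonneg m⟩
  set p := ⨅ m, levelFPP G m
  have hp : 0 ≤ p := ge_of_tendsto' hlim hnonneg
  have hbound : ∀ n, 1 ≤ n → (d : ℝ) ^ n * p ≤ 1 := by
    intro n hn
    have hshift : Tendsto (fun m => levelFPP G (n + m)) atTop (𝓝 p) := by
      simpa only [add_comm n] using (tendsto_add_atTop_iff_nat n).2 hlim
    -- Let m → ∞ with n fixed: the index does not depend on m, and both proportions tend to p.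
    have h := le_of_tendsto_of_tendsto' ((hlim.const_mul ((d : ℝ) ^ n)).sub_const 1)
      ((hlim.sub hshift).const_mul ((levelStabilizer d n ⊓ G).relIndex G : ℝ))
      (hG.pow_mul_levelFPP_sub_one_le (by omega) hn)
    rw [sub_self, mul_zero] at h
    linarith
  suffices p = 0 by rwa [this] at hlim
  by_contra hp0
  have hpos : 0 < p := lt_of_le_of_ne hp (Ne.symm hp0)
  obtain ⟨n, hn⟩ := pow_unbounded_of_one_lt p⁻¹ (show (1 : ℝ) < d by exact_mod_cast hd)
  -- The exponent `n` may be 0, where `hbound` does not apply, hence the shift by one.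
  have h1 := hbound (n + 1) (by omega)
  have h2 : (d : ℝ) ^ n ≤ (d : ℝ) ^ (n + 1) :=
    pow_le_pow_right₀ (by exact_mod_cast (show 1 ≤ d by omega)) (Nat.le_succ n)
  have h3 : 1 < (d : ℝ) ^ n * p := by rwa [inv_lt_iff_one_lt_mul₀ hpos] at hn
  nlinarith

end RegularTree

theorem mainTheorem1 (d : ℕ) (hd : 2 ≤ d) (G : Subgroup (RegularTree.Aut d))
    (hG : RegularTree.IsSuperStronglyFractal G) :
    Tendsto (RegularTree.levelFPP G) atTop (𝓝 (RegularTree.FPP G)) ∧ RegularTree.FPP G = 0 := by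
  have h := hG.tendsto_levelFPP hd
  have h0 : RegularTree.FPP G = 0 := h.limUnder_eq
  exact ⟨h0.symm ▸ h, h0⟩
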